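/- **Setting.** Let $\Omega\subset\mathbb{R}^d$ be a bounded open set with Lebesgue-null boundary (e.g. a polygonal or polyhedral domain), let $V$ be a complex vector space of functions in $L^2(\Omega)$ and let $a(\cdot,\cdot)$ be a Hermitian positive definite sesquilinear form on $V$ with restrictions $a(\cdot,\cdot)_D$ to the measurable sets $D\subseteq\Omega$: these are Hermitian and positive semidefinite, $a(u,v)_D=0$ if $u=0$ a.e. on $D$, $a(\cdot,\cdot)_{D\cup D'}=a(\cdot,\cdot)_D+a(\cdot,\cdot)_{D'}$ for disjoint $D,D'$, and $a(\cdot,\cdot)_\Omega=a(\cdot,\cdot)$. Let $\mathcal T_h$ be a finite partition of $\Omega$ into elements, and let $V_h\subseteq V$ be a finite dimensional subspace. Let $\bar\Omega=\bigcup_{i=1}^N\bar\Omega_i$ with pairwise disjoint open $\Omega_i\subseteq\Omega$, and let $\Omega'_i$ be open with $\Omega_i\subseteq\Omega'_i\subseteq\Omega$; elements and subdomains have null boundaries. Put $a_i=a(\cdot,\cdot)_{\Omega_i}$, $\mathcal S^{(i)}=\{j:\Omega'_j\cap\Omega'_i\neq\emptyset\}$ and $M=\max_i|\mathcal S^{(i)}|$.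 Let $\theta_i:\bar\Omega\to[0,1]$ satisfy $\sum_i\theta_i=1$ and $\operatorname{supp}\theta_i\subseteq\bar\Omega'_i$, with $\theta_iu\in V$ for $u\in V_h$. For $D\subseteq\Omega$ let $V_h(D)$ be the space of those $u\in V_h$ that vanish a.e. outside $D$. Let $I_h:V\to V_h$ be linear with $I_hv=v$ and $I_h(\theta_iv)\in V_h(\Omega'_i)$ for $v\in V_h$. For every $i$ let $s_i$ be a Hermitian positive semidefinite sesquilinear form on $V$ with $s_i(u,v)=0$ if $u=0$ a.e. on $\Omega_i$, positive definite on $V_h|_{\Omega_i}$, and put $\|u\|_{s_i}^2=s_i(u,u)$. **Auxiliary spaces.** Fix $\Lambda>1$. For every $i$ let $\phi^{(i)}_1,\dots,\phi^{(i)}_{n_i}$ be a basis of $V_h|_{\Omega_i}$ of eigenfunctions of $s_i(\phi,w)=\lambda a_i(\phi,w)$ for all $w\in V_h|_{\Omega_i}$, with $s_i(\phi^{(i)}_j,\phi^{(i)}_l)=0=a_i(\phi^{(i)}_j,\phi^{(i)}_l)$ for $j\ne l$, $s_i(\phi^{(i)}_j,\phi^{(i)}_j)=1$ and $\lambda^{(i)}_1\ge\dots\ge\lambda^{(i)}_{l_i}\ge\Lambda>\lambda^{(i)}_{l_i+1}\ge\dots\ge\lambda^{(i)}_{n_i}$,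 where $\lambda=\infty$ is allowed and means $a_i(\phi,\cdot)=0$. Let $V_{aux}^{(i)}=\operatorname{span}\{\phi^{(i)}_j:j\le l_i\}$, let $\pi_iv\in V_{aux}^{(i)}$ be defined by $s_i(\pi_iv,w)=s_i(v,w)$ for all $w\in V_{aux}^{(i)}$, let $\tilde V=\{v\in V_h:s_i(v,w)=0\ \forall w\in V^{(i)}_{aux},\ \forall i\}$, let $V_0$ be the $a$-orthogonal complement of $\tilde V$ in $V_h$, and $b(u,v)=a(u,v)+\sum_{l}s_l(\pi_lu,\pi_lv)$. **Preconditioner.** For an integer $k$ let $\Omega^{(i)}_{k,H}$ be $\Omega_i$ extended by $k$ layers of neighbouring subdomains (subdomains whose closures intersect are neighbours), let $V^{(i)}_{k,H}=V_h(\Omega^{(i)}_{k,H})$, let $\bar\psi^{(i)}_{j,k}\in V^{(i)}_{k,H}$ solve $b(\bar\psi^{(i)}_{j,k},v)=s_i(\phi^{(i)}_j,\pi_iv)$ for all $v\in V^{(i)}_{k,H}$, and let $V_0^{k}=\operatorname{span}\{\bar\psi^{(i)}_{j,k}:1\le j\le l_i,\ 1\le i\le N\}$. Let $(\cdot,\cdot)$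 be the $L^2(\Omega)$ inner product, and let $A_h$ on $V_h$, $A_j$ on $V_h(\Omega_j')$ and $A_0^k$ on $V_0^k$ be the operators with $(A_hu,v)=a(u,v)$, $(A_ju,v)=a(u,v)_{\Omega'_j}$ and $(A_0^ku,v)=a(u,v)$ for all $u,v$ in the respective space. With $\Pi_j,\Pi_0^k$ the inclusions into $V_h$ and $*$ denoting adjoints, put $$B^{-1}_{k,\bar\psi}=\sum_{j=1}^N\Pi_jA_j^{-1}\Pi_j^*+\Pi_0^k(A_0^k)^{-1}(\Pi_0^k)^*.$$ **Assumptions.** There are positive constants $\tilde C,C_{I_a},C_{I_s},C_p$ such that 1. $a_i(\theta_ju,\theta_ju)\le\tilde C(a_i(u,u)+s_i(u,u))$ for all $u\in V_h$, all $i$ and $j\in\mathcal S^{(i)}$, and $\|\eta u\|_{s_i}\le\|\eta\|_{L^\infty(\Omega_i)}\|u\|_{s_i}$ for all $u\in V_h$ and $\eta\in L^\infty(\Omega_i)$ for which $\eta u$ coincides on $\Omega_i$ with an element of $V$; 2. $a(I_hu,I_hu)_\tau\le C_{I_a}a(u,u)_\tau$ for all $\tau\in\mathcal T_h$, and $\sum_l\|I_hu\|_{s_l}^2\le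 C_{I_s}\sum_l\|u\|_{s_l}^2$, for all $u\in V$; 3. $\sum_l\|\pi_lu_0\|_{s_l}^2\le C_p\,a(u_0,u_0)$ for all $u_0\in V_0$. **Corollary.** Let $\tilde C,C_{I_a},C_{I_s},C_p$ be fixed constants. Then there is a constant $K$ depending only on $\Lambda$ and $M$ (and on these fixed constants), and in particular not on $d$, the domain, the form, the mesh, $V_h$, the decompositions or $k$, such that for every $k\ge2$ and all data as above satisfying the assumptions, the eigenvalues of $B^{-1}_{k,\bar\psi}A_h$ are real and positive, and the condition number $\kappa(B^{-1}_{k,\bar\psi}A_h)$, the ratio of the largest to the smallest eigenvalue (read as $0$ if $V_h=0$), is at most $K$. -/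

import Mathlib

open MeasureTheory Set
open scoped ComplexConjugate ENNReal

noncomputable section

namespace TLOS

/-- Points of `ℝ^d`. -/
abbrev Pt (d : ℕ) := EuclideanSpace ℝ (Fin d)

/-- The complex space `L²(Ω)`. -/
abbrev L2 {d : ℕ} (Ω : Set (Pt d)) := Lp ℂ 2 (volume.restrict Ω)

/-- Sesquilinear forms, linear in the first and conjugate linear in the second argument. -/
abbrev SesqForm (F : Type*) [AddCommGroup F] [Module ℂ F] := F →ₗ[ℂ] F →ₗ⋆[ℂ] ℂ

/-- The restriction of a sesquilinear form to a subspace. -/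
abbrev SesqForm.onSub {F : Type*} [AddCommGroup F] [Module ℂ F] (c : SesqForm F)
    (W : Submodule ℂ F) : SesqForm W :=
  c.domRestrict₁₂ W W

/-- The value `c(u,u)`, as a real number (it is real for the Hermitian forms below). -/
def SesqForm.quad {F : Type*} [AddCommGroup F] [Module ℂ F] (c : SesqForm F) (u : F) : ℝ :=
  (c u u).re

/-- Hermitian and positive semidefinite. -/
structure SesqForm.IsHermNonneg {F : Type*} [AddCommGroup F] [Module ℂ F]
    (c : SesqForm F) : Prop where
  herm : ∀ u v, c u v = conj (c v u)
  nonneg : ∀ u, 0 ≤ c.quad u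

/-- The form `(u, v) ↦ s(p u, p v)`. -/
def SesqForm.comp {F : Type*} [AddCommGroup F] [Module ℂ F] (s : SesqForm F) (p : F →ₗ[ℂ] F) :
    SesqForm F :=
  LinearMap.mk₂'ₛₗ (RingHom.id ℂ) (starRingEnd ℂ) (fun u v => s (p u) (p v))
    (by simp) (by simp) (by simp) (by simp)

/-- For an `s`-orthonormal family `φ`, the `s`-orthogonal projection `v ↦ ∑ s(v, φ_j) φ_j` onto the
span of the `φ_j`, `j ∈ t`. -/
def orthProj {F ι : Type*} [AddCommGroup F] [Module ℂ F] (s : SesqForm F) (φ : ι → F)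
    (t : Finset ι) : F →ₗ[ℂ] F :=
  ∑ j ∈ t, (s.flip (φ j)).smulRight (φ j)

theorem orthProj_mem {F ι : Type*} [AddCommGroup F] [Module ℂ F] (s : SesqForm F) (φ : ι → F)
    (t : Finset ι) (v : F) : orthProj s φ t v ∈ Submodule.span ℂ (φ '' t) := by
  simp only [orthProj, LinearMap.sum_apply, LinearMap.smulRight_apply]
  exact Submodule.sum_mem _ fun j hj =>
    Submodule.smul_mem _ _ (Submodule.subset_span ⟨j, hj, rfl⟩)

theorem orthProj_spec {F ι : Type*} [AddCommGroup F] [Module ℂ F] (s : SesqForm F) (φ : ι → F)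
    (t : Finset ι) (horth : ∀ j l, j ≠ l → s (φ j) (φ l) = 0) (hnorm : ∀ j, s (φ j) (φ j) = 1)
    (v w : F) (hw : w ∈ Submodule.span ℂ (φ '' t)) : s (orthProj s φ t v) w = s v w := by
  induction hw using Submodule.span_induction with
  | mem x hx =>
    obtain ⟨j, hj, rfl⟩ := hx
    simp only [orthProj, LinearMap.sum_apply, LinearMap.smulRight_apply, map_sum,
      map_smul, LinearMap.smul_apply, LinearMap.flip_apply]
    rw [Finset.sum_eq_single j]
    · simp [hnorm]
    · intro l _ hl
      simp [horth l j hl]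
    · intro h
      exact absurd hj h
  | zero => simp
  | add x y _ _ hx hy => simp [hx, hy]
  | smul c x _ hx => simp [hx]

/-- `u = 0` almost everywhere on `D` (only `D ∩ Ω` matters). -/
def VanishesOn {d : ℕ} {Ω : Set (Pt d)} (u : L2 Ω) (D : Set (Pt d)) : Prop :=
  ∀ᵐ x ∂(volume.restrict Ω), x ∈ D → u x = 0

/-- `w = η u` almost everywhere on `D` (only `D ∩ Ω` matters). -/
def IsProductOn {d : ℕ} {Ω : Set (Pt d)} (η : Pt d → ℂ) (u w : L2 Ω) (D : Set (Pt d)) : Prop :=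
  ∀ᵐ x ∂(volume.restrict Ω), x ∈ D → w x = η x * u x

/-- Bounded open sets with Lebesgue-null boundary; all bounded polygonal (polyhedral) open sets
are of this kind. -/
structure IsRegion {d : ℕ} (D : Set (Pt d)) : Prop where
  isOpen : IsOpen D
  bounded : Bornology.IsBounded D
  frontier_null : volume (frontier D) = 0

/-- A nonoverlapping division `Ω̄ = ⋃ D̄_i`, with pairwise disjoint open pieces `D_i ⊆ Ω`. -/
structure IsDivision {d n : ℕ} (Ω : Set (Pt d)) (D : Fin n → Set (Pt d)) : Prop where
  region : ∀ i, IsRegion (D i)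
  subset : ∀ i, D i ⊆ Ω
  disjoint : ∀ i j, i ≠ j → Disjoint (D i) (D j)
  cover : closure Ω = ⋃ i, closure (D i)

/-- A sesquilinear form on a space `V` of functions on `Ω` together with its restrictions
`a(·,·)_D` to the measurable parts `D` of `Ω`; the form itself is `a(·,·)_Ω`.  The restriction to
`D` only sees the values of its arguments on `D`, and restrictions add up over disjoint parts.
(Then parts that differ by a null set, such as a region and its closure, give the same form.) -/
structure LocalForm {d : ℕ} (Ω : Set (Pt d)) (V : Submodule ℂ (L2 Ω)) where
  on : Set (Pt d) → SesqForm V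
  hermNonneg : ∀ D, MeasurableSet D → D ⊆ Ω → (on D).IsHermNonneg
  loc : ∀ D, MeasurableSet D → D ⊆ Ω → ∀ u v : V, VanishesOn (u : L2 Ω) D → on D u v = 0
  additive : ∀ D D', MeasurableSet D → MeasurableSet D' → D ⊆ Ω → D' ⊆ Ω → Disjoint D D' →
    on (D ∪ D') = on D + on D'

/-- The Hermitian positive definite variational problem on `V(Ω)` and its discretization: the mesh
`T_h` of `Ω` and the finite dimensional space `V_h ⊆ V(Ω)`. -/
structure Discretization (d : ℕ) where
  Ω : Set (Pt d)
  region : IsRegion Ω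
  V : Submodule ℂ (L2 Ω)
  a : LocalForm Ω V
  posDef : ∀ u : V, u ≠ 0 → 0 < (a.on Ω).quad u
  numCells : ℕ
  cell : Fin numCells → Set (Pt d)
  mesh : IsDivision Ω cell
  Vh : Submodule ℂ V
  finDim : FiniteDimensional ℂ Vh

attribute [instance] Discretization.finDim

variable {d : ℕ}

/-- The underlying `L²(Ω)` function of an element of `V_h`. -/
def Discretization.fn (P : Discretization d) (u : P.Vh) : L2 P.Ω := ((u : P.V) : L2 P.Ω)

/-- The subspace of the functions in `V_h` that are supported in `D`. -/
def Discretization.supportedIn (P : Discretization d) (D : Set (Pt d)) : Submodule ℂ P.Vh where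
  carrier := {u | ∀ᵐ x ∂(volume.restrict P.Ω), x ∈ Dᶜ → P.fn u x = 0}
  zero_mem' := by
    have h := Lp.coeFn_zero ℂ 2 (volume.restrict P.Ω)
    filter_upwards [h] with x hx _
    simpa [Discretization.fn] using hx
  add_mem' := by
    intro u v hu hv
    have h := Lp.coeFn_add (P.fn u) (P.fn v)
    rw [mem_ofPred_eq] at hu hv ⊢
    filter_upwards [h, hu, hv] with x hx h1 h2 hD
    have : P.fn (u + v) = P.fn u + P.fn v := rfl
    rw [this, hx, Pi.add_apply, h1 hD, h2 hD, add_zero]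
  smul_mem' := by
    intro c u hu
    have h := Lp.coeFn_smul c (P.fn u)
    rw [mem_ofPred_eq] at hu ⊢
    filter_upwards [h, hu] with x hx h1 hD
    have : P.fn (c • u) = c • P.fn u := rfl
    rw [this, hx, Pi.smul_apply, h1 hD, smul_zero]

/-- The form `a(·,·)_D` on `V_h`. -/
def Discretization.ah (P : Discretization d) (D : Set (Pt d)) : SesqForm P.Vh :=
  (P.a.on D).onSub P.Vh

/-- The nonoverlapping subdomains `Ω_i`, the overlapping subdomains `Ω'_i ⊇ Ω_i`, the partition of
unity `θ_i` subordinate to the latter, and the interpolation operator `I_h`. -/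
structure Decomposition (P : Discretization d) where
  N : ℕ
  sub : Fin N → Set (Pt d)
  division : IsDivision P.Ω sub
  ovl : Fin N → Set (Pt d)
  ovl_region : ∀ i, IsRegion (ovl i)
  sub_subset : ∀ i, sub i ⊆ ovl i
  ovl_subset : ∀ i, ovl i ⊆ P.Ω
  θ : Fin N → Pt d → ℝ
  θ_sum : ∀ x ∈ closure P.Ω, ∑ i, θ i x = 1
  θ_mem : ∀ i, ∀ x ∈ closure P.Ω, θ i x ∈ Icc (0 : ℝ) 1
  θ_supp : ∀ i, ∀ x ∈ closure P.Ω, x ∉ closure (ovl i) → θ i x = 0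
  /-- The products `θ_i u`, `u ∈ V_h`, belong to `V(Ω)`. -/
  θ_mul : ∀ i, ∀ u : P.Vh, ∃ w : P.V, IsProductOn (fun x => (θ i x : ℂ)) (P.fn u) w univ
  Ih : P.V →ₗ[ℂ] P.Vh
  Ih_proj : ∀ u : P.Vh, Ih (u : P.V) = u
  /-- `I_h(θ_i u) ∈ V_h(Ω'_i)` for `u ∈ V_h`. -/
  Ih_supp : ∀ i, ∀ u : P.Vh, ∀ w : P.V, IsProductOn (fun x => (θ i x : ℂ)) (P.fn u) w univ →
    Ih w ∈ P.supportedIn (ovl i)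

/-- `S^(i) = {j : Ω'_j ∩ Ω'_i ≠ ∅}`. -/
def Decomposition.nbrs {P : Discretization d} (Q : Decomposition P) (i : Fin Q.N) :
    Set (Fin Q.N) :=
  {j | (Q.ovl j ∩ Q.ovl i).Nonempty}

/-- `M = max_i |S^(i)|`. -/
def Decomposition.overlap {P : Discretization d} (Q : Decomposition P) : ℕ :=
  Finset.univ.sup fun i => (Q.nbrs i).ncard

/-- The indices of the subdomains in `Ω_i` extended by `k` layers of neighbouring subdomains. -/
def Decomposition.layer {P : Discretization d} (Q : Decomposition P) (i : Fin Q.N) :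
    ℕ → Set (Fin Q.N)
  | 0 => {i}
  | k + 1 => Q.layer i k ∪
      {j | ∃ l ∈ Q.layer i k, (closure (Q.sub j) ∩ closure (Q.sub l)).Nonempty}

/-- The region consisting of `Ω_i` and `k` layers of neighbouring subdomains. -/
def Decomposition.patch {P : Discretization d} (Q : Decomposition P) (k : ℕ) (i : Fin Q.N) :
    Set (Pt d) :=
  ⋃ j ∈ Q.layer i k, P.Ω ∩ closure (Q.sub j)

/-- The auxiliary forms `s_i`: Hermitian, depending only on the values on `Ω_i`, nonnegative, and
positive definite on `V_h(Ω̄_i) = V_h|_{Ω̄_i}`. -/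
structure AuxForms {P : Discretization d} (Q : Decomposition P) where
  s : Fin Q.N → SesqForm P.V
  hermNonneg : ∀ i, (s i).IsHermNonneg
  loc : ∀ i, ∀ u v : P.V, VanishesOn (u : L2 P.Ω) (Q.sub i) → s i u v = 0
  posDef : ∀ i, ∀ u : P.Vh, ¬ VanishesOn (P.fn u) (Q.sub i) → 0 < (s i).quad (u : P.V)

/-- The form `s_i` on `V_h`. -/
def AuxForms.sh {P : Discretization d} {Q : Decomposition P} (S : AuxForms Q) (i : Fin Q.N) :
    SesqForm P.Vh :=
  (S.s i).onSub P.Vh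

/-- `a_i(θ_j u, θ_j u) ≤ C (a_i(u,u) + s_i(u,u))` and `‖η u‖_{s_i} ≤ ‖η‖_{L^∞(Ω_i)} ‖u‖_{s_i}`. -/
structure Assumption1 {P : Discretization d} {Q : Decomposition P} (S : AuxForms Q)
    (C : ℝ) : Prop where
  bound : ∀ i, ∀ j ∈ Q.nbrs i, ∀ u : P.Vh, ∀ w : P.V,
    IsProductOn (fun x => (Q.θ j x : ℂ)) (P.fn u) w univ →
      (P.a.on (Q.sub i)).quad w ≤ C * ((P.ah (Q.sub i)).quad u + (S.sh i).quad u)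
  mul_bound : ∀ i, ∀ η : Pt d → ℂ, MemLp η ∞ (volume.restrict (Q.sub i)) →
    ∀ u : P.Vh, ∀ w : P.V, IsProductOn η (P.fn u) w (Q.sub i) →
      √((S.s i).quad w) ≤
        (eLpNorm η ∞ (volume.restrict (Q.sub i))).toReal * √((S.sh i).quad u)

/-- Stability of the interpolation operator. -/
structure Assumption2 {P : Discretization d} {Q : Decomposition P} (S : AuxForms Q)
    (Ca Cs : ℝ) : Prop where
  bound_a : ∀ u : P.V, ∀ t, (P.ah (P.cell t)).quad (Q.Ih u) ≤ Ca * (P.a.on (P.cell t)).quad u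
  bound_s : ∀ u : P.V, ∑ l, (S.sh l).quad (Q.Ih u) ≤ Cs * ∑ l, (S.s l).quad u

/-- Generalized eigenfunctions: `s(φ, w) = λ a(φ, w)` for all `w`.  The eigenvalue `∞` is the one of
the functions on which `a` degenerates, `a(φ, w) = 0` for all `w`. -/
def IsEigenpair {F : Type*} [AddCommGroup F] [Module ℂ F] (s a : SesqForm F) (φ : F)
    (lam : ℝ≥0∞) : Prop :=
  (lam ≠ ∞ → ∀ w, s φ w = (lam.toReal : ℂ) * a φ w) ∧ (lam = ∞ → ∀ w, a φ w = 0)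

/-- For every `i`, a basis `φ_1, …, φ_n` of `V_h(Ω̄_i)` that consists of eigenfunctions of
`s_i(φ, w) = λ a_i(φ, w)`, orthogonal with respect to `s_i` and `a_i`, normalized by
`s_i(φ_j, φ_j) = 1`, with eigenvalues in descending order.  A function on `Ω̄_i` is represented by
an element of `V_h` that restricts to it; `a_i` and `s_i` do not depend on the representative.
The eigenvalue `∞` does not occur if `a_i` is definite on `V_h(Ω̄_i)`. -/
structure Eigenbasis {P : Discretization d} {Q : Decomposition P} (S : AuxForms Q) where
  n : Fin Q.N → ℕ
  φ : (i : Fin Q.N) → Fin (n i) → P.Vh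
  lam : (i : Fin Q.N) → Fin (n i) → ℝ≥0∞
  eigen : ∀ i j, IsEigenpair (S.sh i) (P.ah (Q.sub i)) (φ i j) (lam i j)
  antitone : ∀ i, Antitone (lam i)
  orth_s : ∀ i j l, j ≠ l → S.sh i (φ i j) (φ i l) = 0
  orth_a : ∀ i j l, j ≠ l → P.ah (Q.sub i) (φ i j) (φ i l) = 0
  norm_s : ∀ i j, S.sh i (φ i j) (φ i j) = 1
  basis : ∀ i, ∀ u : P.Vh, ∃ c : Fin (n i) → ℂ,
    VanishesOn (P.fn (u - ∑ j, c j • φ i j)) (Q.sub i)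

section Coarse

variable {P : Discretization d} {Q : Decomposition P} {S : AuxForms Q} (E : Eigenbasis S) (Λ : ℝ)

/-- The indices `j` with `λ_j^(i) ≥ Λ`, that is, `1 ≤ j ≤ l_i`. -/
def Eigenbasis.kept (i : Fin Q.N) : Finset (Fin (E.n i)) :=
  {j | ENNReal.ofReal Λ ≤ E.lam i j}

/-- `V_aux^(i)`, the span of the eigenfunctions with `λ_j^(i) ≥ Λ`. -/
def Eigenbasis.Vaux (i : Fin Q.N) : Submodule ℂ P.Vh :=
  Submodule.span ℂ (E.φ i '' E.kept Λ i)

/-- The projection `π_i` onto `V_aux^(i)`. -/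
def Eigenbasis.proj (i : Fin Q.N) : P.Vh →ₗ[ℂ] P.Vh :=
  orthProj (S.sh i) (E.φ i) (E.kept Λ i)

theorem Eigenbasis.proj_mem (i : Fin Q.N) (v : P.Vh) : E.proj Λ i v ∈ E.Vaux Λ i :=
  orthProj_mem (S.sh i) (E.φ i) (E.kept Λ i) v

/-- The defining property of `π_i`: `s_i(π_i v, w) = s_i(v, w)` for all `w ∈ V_aux^(i)`. -/
theorem Eigenbasis.proj_spec (i : Fin Q.N) (v w : P.Vh) (hw : w ∈ E.Vaux Λ i) :
    S.sh i (E.proj Λ i v) w = S.sh i v w :=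
  orthProj_spec (S.sh i) (E.φ i) (E.kept Λ i) (E.orth_s i) (E.norm_s i) v w hw

/-- `Ṽ = {v ∈ V_h : s_i(v,w) = 0 for all w ∈ V_aux^(i) and all i}`. -/
def Eigenbasis.Vtilde : Submodule ℂ P.Vh :=
  ⨅ i, ⨅ w ∈ E.Vaux Λ i, LinearMap.ker ((S.sh i).flip w)

/-- The coarse space `V_0`, the `a`-orthogonal complement of `Ṽ` in `V_h`. -/
def Eigenbasis.V0 : Submodule ℂ P.Vh :=
  ⨅ v ∈ E.Vtilde Λ, LinearMap.ker ((P.ah P.Ω).flip v)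

/-- `∑_l ‖π_l u_0‖²_{s_l} ≤ C_p a(u_0, u_0)` for all `u_0 ∈ V_0`. -/
def Assumption3 (Cp : ℝ) : Prop :=
  ∀ u₀ ∈ E.V0 Λ, ∑ l, (S.sh l).quad (E.proj Λ l u₀) ≤ Cp * (P.ah P.Ω).quad u₀

/-- `b(u,v) = a(u,v) + ∑_l s_l(π_l u, π_l v)`. -/
def Eigenbasis.b : SesqForm P.Vh :=
  P.ah P.Ω + ∑ l, (S.sh l).comp (E.proj Λ l)

/-- The economical coarse space: the span of the functions `ψ̄_{j,k}^(i)`, `λ_j^(i) ≥ Λ`, where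
`ψ̄_{j,k}^(i)` is the solution in `V_{k,H}^(i)`, the functions in `V_h` supported in `Ω_i` and `k`
layers of subdomains around it, of `b(ψ̄, v) = s_i(φ_j^(i), π_i v)` for all `v ∈ V_{k,H}^(i)`. -/
def Eigenbasis.coarse (k : ℕ) : Submodule ℂ P.Vh :=
  Submodule.span ℂ {ψ | ∃ i, ∃ j ∈ E.kept Λ i, ψ ∈ P.supportedIn (Q.patch k i) ∧
    ∀ v ∈ P.supportedIn (Q.patch k i), E.b Λ ψ v = S.sh i (E.φ i j) (E.proj Λ i v)}

end Coarse

section Operators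

variable {F : Type*} [NormedAddCommGroup F] [InnerProductSpace ℂ F] [FiniteDimensional ℂ F]

/-- The operator `A` with `(A u, v) = c(u,v)`, where `(·,·)` is the inner product of `F`. -/
def operatorOf (c : SesqForm F) : Module.End ℂ F :=
  ∑ k, (c.flip (stdOrthonormalBasis ℂ F k)).smulRight (stdOrthonormalBasis ℂ F k)

/-- The defining property of `operatorOf c`: `(A u, v) = c(u,v)`.  (The inner product of Mathlib is
conjugate linear in the first argument, so `(x, y)` is `inner ℂ y x`.) -/
theorem inner_operatorOf (c : SesqForm F) (u v : F) : inner ℂ v (operatorOf c u) = c u v := by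
  conv_rhs => rw [← (stdOrthonormalBasis ℂ F).sum_repr' v]
  simp only [operatorOf, LinearMap.sum_apply, LinearMap.smulRight_apply, LinearMap.flip_apply,
    inner_sum, inner_smul_right, map_sum, LinearMap.map_smulₛₗ, smul_eq_mul]
  refine Finset.sum_congr rfl fun k _ => ?_
  rw [inner_conj_symm, mul_comm]

/-- `Π_W A_W⁻¹ Π_W^*`, where `Π_W : W → F` is the inclusion, `Π_W^*` its adjoint, and `A_W` the
operator on `W` with `(A_W u, v) = c(u,v)` for `u, v ∈ W`. -/
def subspaceCorrection (c : SesqForm F) (W : Submodule ℂ F) : Module.End ℂ F :=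
  W.subtype ∘ₗ Ring.inverse (operatorOf (c.onSub W)) ∘ₗ LinearMap.adjoint W.subtype

/-- The condition number `κ(T)`: the ratio of the extreme eigenvalues (in modulus). -/
def condNumber (T : Module.End ℂ F) : ℝ :=
  sSup ((fun z : ℂ => ‖z‖) '' spectrum ℂ T) / sInf ((fun z : ℂ => ‖z‖) '' spectrum ℂ T)

end Operators

/-- The operator `A_h` on `V_h`, `(A_h u, v) = a(u,v)`. -/
def Discretization.Ah (P : Discretization d) : Module.End ℂ P.Vh :=
  operatorOf (F := P.Vh) (P.ah P.Ω)

/-- The economical preconditioner: the sum of the corrections on the spaces `V_h(Ω'_j)` and of the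
one on the economical coarse space. -/
def Eigenbasis.precond {P : Discretization d} {Q : Decomposition P} {S : AuxForms Q}
    (E : Eigenbasis S) (Λ : ℝ) (k : ℕ) : Module.End ℂ P.Vh :=
  ∑ j, subspaceCorrection (F := P.Vh) (P.ah (Q.ovl j)) (P.supportedIn (Q.ovl j)) +
    subspaceCorrection (F := P.Vh) (P.ah P.Ω) (E.coarse Λ k)

end TLOS

end

/-!
The preconditioned operator is `∑_j P_j + P_0`, where `P_j` and `P_0` are the `a`-orthogonal
projections onto `V_h(Ω'_j)` and onto the coarse space: on `V_h(Ω'_j)` the form `a(·,·)_{Ω'_j}`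
is `a` itself.  The operator is symmetric for `a`, so its spectrum lies between the bounds of
`∑_j a(P_j u, P_j u) + a(P_0 u, P_0 u)` relative to `a(u, u)`
(`condNumber_additiveSchwarz_le`).

*Upper bound.*  `a(P_j u, P_j u) ≤ a(u, u)_{Ω'_j}`, and a subdomain `Ω_i` meets at most `M` of the
`Ω'_j`, so that these energies add up to at most `M a(u, u)` (`Decomposition.sum_quad_ovl_le`).
With the coarse space the bound is `M + 1`, for every coarse space.

*Lower bound.*  By duality it suffices to split every `u ∈ V_h` into local parts `u_j ∈ V_h(Ω'_j)`
with `∑_j a(u_j, u_j) ≤ L a(u, u)`; the coarse component may be taken to be zero, since the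
constant may depend on `C_p`.  Indeed the splitting `u_j = I_h(θ_j u)` is stable in the norm
`a(u, u) + ∑_l s_l(u, u)` (`Decomposition.exists_stable_splitting`), and the additional term is
dominated by the energy (`Eigenbasis.sum_quad_s_le`): write `u = u₀ + ũ` with `u₀ ∈ V_0` and
`ũ ∈ Ṽ` orthogonal for `a`.  The components of `u` in the auxiliary spaces are
those of `u₀`, which the third assumption bounds by `C_p a(u₀, u₀) ≤ C_p a(u, u)`, while on the
remaining eigenfunctions `s_l ≤ Λ a_l`.  Hence `∑_l s_l(u, u) ≤ (C_p + Λ) a(u, u)`, and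
`L = C_{I_a} M C̃ (1 + C_p + Λ)` will do if it is positive.  None of this depends
on the number `k` of layers.
-/

namespace TLOS

/-! ### Sesquilinear forms -/

section Forms

variable {F : Type*} [AddCommGroup F] [Module ℂ F] {c : SesqForm F}

theorem SesqForm.IsHermNonneg.onSub (hc : c.IsHermNonneg) (W : Submodule ℂ F) :
    (c.onSub W).IsHermNonneg :=
  ⟨fun u v => hc.herm u v, fun u => hc.nonneg u⟩

theorem SesqForm.IsHermNonneg.self_eq_quad (hc : c.IsHermNonneg) (u : F) :
    c u u = (c.quad u : ℂ) :=
  (Complex.conj_eq_iff_re.1 (hc.herm u u).symm).symm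

theorem SesqForm.IsHermNonneg.quad_sub (hc : c.IsHermNonneg) (u v : F) :
    c.quad (u - v) = c.quad u - 2 * (c u v).re + c.quad v := by
  have h : (c v u).re = (c u v).re := by rw [hc.herm v u, Complex.conj_re]
  simp only [SesqForm.quad, map_sub, LinearMap.sub_apply, Complex.sub_re, h]
  ring

theorem SesqForm.quad_smul (c : SesqForm F) (z : ℂ) (u : F) :
    c.quad (z • u) = ‖z‖ ^ 2 * c.quad u := by
  have h : c (z • u) (z • u) = ((‖z‖ ^ 2 : ℝ) : ℂ) * c u u := by
    simp only [map_smul, LinearMap.map_smulₛₗ, LinearMap.smul_apply, smul_eq_mul]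
    rw [← mul_assoc, mul_comm (conj z), Complex.mul_conj, Complex.normSq_eq_norm_sq]
  rw [SesqForm.quad, h, Complex.re_ofReal_mul, SesqForm.quad]

theorem SesqForm.IsHermNonneg.two_mul_re_le (hc : c.IsHermNonneg) (t : ℝ) (u v : F) :
    2 * t * (c u v).re ≤ c.quad u + t ^ 2 * c.quad v := by
  have h := hc.nonneg (u - (t : ℂ) • v)
  have h' : (c u ((t : ℂ) • v)).re = t * (c u v).re := by
    rw [LinearMap.map_smulₛₗ, Complex.conj_ofReal, smul_eq_mul, Complex.re_ofReal_mul]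
  rw [hc.quad_sub, h', c.quad_smul, Complex.norm_real, Real.norm_eq_abs, sq_abs] at h
  linarith

theorem SesqForm.quad_sum_smul_of_orth {ι : Type*} [Fintype ι] (c : SesqForm F) (φ : ι → F)
    (horth : ∀ j l, j ≠ l → c (φ j) (φ l) = 0) (x : ι → ℂ) :
    c.quad (∑ j, x j • φ j) = ∑ j, ‖x j‖ ^ 2 * c.quad (φ j) := by
  have h : c (∑ j, x j • φ j) (∑ j, x j • φ j) = ∑ j, c (x j • φ j) (x j • φ j) := by
    simp only [map_sum, LinearMap.sum_apply]
    refine Finset.sum_congr rfl fun j _ => Finset.sum_eq_single j (fun l _ hl => ?_) (by simp)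
    simp [horth l j hl]
  rw [SesqForm.quad, h, Complex.re_sum]
  exact Finset.sum_congr rfl fun j _ => c.quad_smul (x j) (φ j)

theorem SesqForm.quad_sum {ι : Type*} (s : Finset ι) (f : ι → SesqForm F) (u : F) :
    SesqForm.quad (∑ i ∈ s, f i) u = ∑ i ∈ s, (f i).quad u := by
  simp [SesqForm.quad, LinearMap.sum_apply, Complex.re_sum]

theorem SesqForm.IsHermNonneg.quad_congr (hc : c.IsHermNonneg) {u w : F}
    (h : ∀ v, c (u - w) v = 0) : c.quad u = c.quad w := by
  have h1 : c u u = c w u := by simpa [sub_eq_zero] using h u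
  have h2 : c u w = c w w := by simpa [sub_eq_zero] using h w
  rw [SesqForm.quad, SesqForm.quad, h1, hc.herm w u, h2, Complex.conj_re]

theorem orthProj_sub_of_orth {ι : Type*} {s : SesqForm F} {φ : ι → F} {t : Finset ι} {p : F}
    (h : ∀ j ∈ t, s p (φ j) = 0) (u : F) : orthProj s φ t (u - p) = orthProj s φ t u := by
  have h0 : orthProj s φ t p = 0 := by
    rw [orthProj, LinearMap.sum_apply]
    refine Finset.sum_eq_zero fun j hj => ?_
    rw [LinearMap.smulRight_apply, LinearMap.flip_apply, h j hj, zero_smul]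
  rw [map_sub, h0, sub_zero]

/-- If `u` has an expansion, modulo the kernels of `s` and `a`, in an `s`-orthonormal and
`a`-orthogonal family whose members outside `t` satisfy `s(φ, φ) ≤ Λ a(φ, φ)`, then `s(u, u)` is
controlled by the projection of `u` on the members in `t` and by `Λ a(u, u)`. -/
theorem SesqForm.IsHermNonneg.quad_le_quad_orthProj_add {ι : Type*} [Fintype ι]
    {s a : SesqForm F} (hs : s.IsHermNonneg) (ha : a.IsHermNonneg) {φ : ι → F} {t : Finset ι}
    (orth_s : ∀ j l, j ≠ l → s (φ j) (φ l) = 0) (orth_a : ∀ j l, j ≠ l → a (φ j) (φ l) = 0)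
    (norm_s : ∀ j, s (φ j) (φ j) = 1) {Λ : ℝ} (hΛ : 0 ≤ Λ)
    (hsmall : ∀ j ∉ t, 1 ≤ Λ * a.quad (φ j)) {u : F} {x : ι → ℂ}
    (hs0 : ∀ v, s (u - ∑ j, x j • φ j) v = 0) (ha0 : ∀ v, a (u - ∑ j, x j • φ j) v = 0) :
    s.quad u ≤ s.quad (orthProj s φ t u) + Λ * a.quad u := by
  classical
  have hcoef : ∀ j, s u (φ j) = x j := by
    intro j
    have h : s u (φ j) = s (∑ j, x j • φ j) (φ j) := by
      have := hs0 (φ j)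
      rwa [map_sub, LinearMap.sub_apply, sub_eq_zero] at this
    rw [h, map_sum, LinearMap.sum_apply, Finset.sum_eq_single j]
    · simp [norm_s]
    · intro l _ hl
      simp [orth_s l j hl]
    · simp
  have hproj : orthProj s φ t u = ∑ j, (if j ∈ t then x j else 0) • φ j := by
    simp [orthProj, hcoef, LinearMap.sum_apply, ite_smul, Finset.sum_ite_mem]
  have hnorm : ∀ j, s.quad (φ j) = 1 := fun j => by simp [SesqForm.quad, norm_s]
  rw [hs.quad_congr hs0, ha.quad_congr ha0, hproj, s.quad_sum_smul_of_orth _ orth_s,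
    s.quad_sum_smul_of_orth _ orth_s, a.quad_sum_smul_of_orth _ orth_a, Finset.mul_sum,
    ← Finset.sum_add_distrib]
  refine Finset.sum_le_sum fun j _ => ?_
  have ha' := ha.nonneg (φ j)
  rw [hnorm]
  split_ifs with hj
  · have : 0 ≤ Λ * (‖x j‖ ^ 2 * a.quad (φ j)) := by positivity
    linarith
  · have := mul_le_mul_of_nonneg_left (hsmall j hj) (sq_nonneg ‖x j‖)
    simp only [norm_zero]
    linarith

end Forms

/-! ### Subspace corrections as projections -/

section Corrections

variable {F : Type*} [NormedAddCommGroup F] [InnerProductSpace ℂ F] [FiniteDimensional ℂ F]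

theorem isUnit_operatorOf {c : SesqForm F} (hpos : ∀ u, u ≠ 0 → 0 < c.quad u) :
    IsUnit (operatorOf c) := by
  rw [LinearMap.isUnit_iff_ker_eq_bot, LinearMap.ker_eq_bot']
  intro u hu
  by_contra hne
  have h := inner_operatorOf c u u
  rw [hu, inner_zero_right] at h
  have h' := hpos u hne
  rw [SesqForm.quad, ← h] at h'
  simp at h'

theorem subspaceCorrection_mem (c : SesqForm F) (W : Submodule ℂ F) (u : F) :
    subspaceCorrection c W u ∈ W := by
  simp [subspaceCorrection]

/-- `Π_W A_W⁻¹ Π_W^* A` solves the variational problem `c(p, v) = a(u, v)` for all `v ∈ W`; for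
`c = a` it is the `a`-orthogonal projection onto `W`. -/
theorem subspaceCorrection_operatorOf {c : SesqForm F} {W : Submodule ℂ F}
    (hpos : ∀ u ∈ W, u ≠ 0 → 0 < c.quad u) (a : SesqForm F) (u : F) {v : F} (hv : v ∈ W) :
    c (subspaceCorrection c W (operatorOf a u)) v = a u v := by
  have hunit : IsUnit (operatorOf (c.onSub W)) :=
    isUnit_operatorOf fun w hw => hpos w w.2 (by simpa using hw)
  set x := LinearMap.adjoint W.subtype (operatorOf a u) with hx
  have h1 : operatorOf (c.onSub W) (Ring.inverse (operatorOf (c.onSub W)) x) = x := by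
    rw [← Module.End.mul_apply, Ring.mul_inverse_cancel _ hunit, Module.End.one_apply]
  have h2 := inner_operatorOf (c.onSub W) (Ring.inverse (operatorOf (c.onSub W)) x) ⟨v, hv⟩
  rw [h1, hx, LinearMap.adjoint_inner_right, inner_operatorOf] at h2
  exact h2.symm

/-- If `a(T u, u)` is a real number `q u` that lies between `L⁻¹ a(u, u)` and `U a(u, u)`, then the
eigenvalues of `T` are positive and `κ(T) ≤ U L`. -/
theorem condNumber_le_of_form_bounds {a : SesqForm F} (ha : a.IsHermNonneg)
    (hpos : ∀ u, u ≠ 0 → 0 < a.quad u) {T : Module.End ℂ F} {L U : ℝ} (hL : 0 < L) (hU : 0 < U)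
    {q : F → ℝ} (hq : ∀ u, a (T u) u = (q u : ℂ)) (hlower : ∀ u, a.quad u ≤ L * q u)
    (hupper : ∀ u, q u ≤ U * a.quad u) :
    (∀ z ∈ spectrum ℂ T, ∃ t : ℝ, 0 < t ∧ z = (t : ℂ)) ∧ condNumber T ≤ U * L := by
  have key : ∀ z ∈ spectrum ℂ T, ∃ t : ℝ, L⁻¹ ≤ t ∧ t ≤ U ∧ z = (t : ℂ) := by
    intro z hz
    obtain ⟨u, hu⟩ := (Module.End.hasEigenvalue_iff_mem_spectrum.2 hz).exists_hasEigenvector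
    have hpu := hpos u hu.2
    have h1 := hq u
    rw [hu.apply_eq_smul, map_smul, LinearMap.smul_apply, ha.self_eq_quad, smul_eq_mul] at h1
    refine ⟨q u / a.quad u, ?_, ?_, ?_⟩
    · rw [le_div_iff₀ hpu, inv_mul_le_iff₀ hL]
      exact hlower u
    · rw [div_le_iff₀ hpu]
      exact hupper u
    · rw [Complex.ofReal_div, ← h1, mul_div_cancel_right₀]
      exact_mod_cast hpu.ne'
  refine ⟨fun z hz => ?_, ?_⟩
  · obtain ⟨t, h1, -, rfl⟩ := key z hz
    exact ⟨t, (inv_pos.2 hL).trans_le h1, rfl⟩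
  have hnorm : ∀ r ∈ (fun z : ℂ => ‖z‖) '' spectrum ℂ T, L⁻¹ ≤ r ∧ r ≤ U := by
    rintro _ ⟨z, hz, rfl⟩
    obtain ⟨t, h1, h2, rfl⟩ := key z hz
    have : 0 ≤ t := (inv_pos.2 hL).le.trans h1
    simp only [Complex.norm_real, Real.norm_eq_abs, abs_of_nonneg this]
    exact ⟨h1, h2⟩
  unfold condNumber
  rcases ((fun z : ℂ => ‖z‖) '' spectrum ℂ T).eq_empty_or_nonempty with he | hne
  · -- The spectrum is empty only if `F = 0`, and then the quotient is `0 / 0 = 0`.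
    rw [he, Real.sSup_empty, zero_div]
    positivity
  · have h1 : L⁻¹ ≤ sInf ((fun z : ℂ => ‖z‖) '' spectrum ℂ T) :=
      le_csInf hne fun r hr => (hnorm r hr).1
    have h2 : sSup ((fun z : ℂ => ‖z‖) '' spectrum ℂ T) ≤ U :=
      csSup_le hne fun r hr => (hnorm r hr).2
    calc _ ≤ U / L⁻¹ := div_le_div₀ hU.le h2 (inv_pos.2 hL) h1
      _ = U * L := by rw [div_inv_eq_mul]

theorem SesqForm.IsHermNonneg.exists_orth_decomp {a : SesqForm F} (ha : a.IsHermNonneg)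
    (hpos : ∀ u, u ≠ 0 → 0 < a.quad u) (W : Submodule ℂ F) (u : F) :
    ∃ p ∈ W, (∀ v ∈ W, a (u - p) v = 0) ∧ a.quad (u - p) ≤ a.quad u := by
  have hpm := subspaceCorrection_mem a W (operatorOf a u)
  have hpv : ∀ v ∈ W, a (subspaceCorrection a W (operatorOf a u)) v = a u v := fun v hv =>
    subspaceCorrection_operatorOf (fun w _ => hpos w) a u hv
  refine ⟨_, hpm, fun v hv => by rw [map_sub, LinearMap.sub_apply, hpv v hv, sub_self], ?_⟩
  rw [ha.quad_sub, ← hpv _ hpm, ha.self_eq_quad, Complex.ofReal_re]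
  linarith [ha.nonneg (subspaceCorrection a W (operatorOf a u))]

/-- Spectral bounds for an additive Schwarz preconditioner whose local forms `c j` agree with `a` on
`W j`.  The preconditioned operator is the sum of the `a`-orthogonal projections onto the spaces
`W j` and `W₀`.  The upper bound comes from the finite overlap of the forms `c j`, the lower one
from the duality between projections and stable splittings, here without a component in `W₀`. -/
theorem condNumber_additiveSchwarz_le {ι : Type*} [Fintype ι] {a : SesqForm F}
    (ha : a.IsHermNonneg) (hpos : ∀ u, u ≠ 0 → 0 < a.quad u) {c : ι → SesqForm F}
    (hc : ∀ j, (c j).IsHermNonneg) {W : ι → Submodule ℂ F} (W₀ : Submodule ℂ F)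
    (hagree : ∀ j, ∀ u ∈ W j, ∀ v, a u v = c j u v) {m L : ℝ} (hm : 0 ≤ m) (hL : 0 < L)
    (hoverlap : ∀ u, ∑ j, (c j).quad u ≤ m * a.quad u)
    (hsplit : ∀ u, ∃ f : ι → F, (∀ j, f j ∈ W j) ∧ ∑ j, f j = u ∧
      ∑ j, a.quad (f j) ≤ L * a.quad u) {B : Module.End ℂ F}
    (hB : B = ∑ j, subspaceCorrection (c j) (W j) + subspaceCorrection a W₀) :
    (∀ z ∈ spectrum ℂ (B * operatorOf a), ∃ t : ℝ, 0 < t ∧ z = (t : ℂ)) ∧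
      condNumber (B * operatorOf a) ≤ (m + 1) * L := by
  let p : ι → F → F := fun j u => subspaceCorrection (c j) (W j) (operatorOf a u)
  let p₀ : F → F := fun u => subspaceCorrection a W₀ (operatorOf a u)
  have hpm : ∀ j u, p j u ∈ W j := fun j u => subspaceCorrection_mem _ _ _
  have hp₀m : ∀ u, p₀ u ∈ W₀ := fun u => subspaceCorrection_mem _ _ _
  have hpv : ∀ j u, ∀ v ∈ W j, a (p j u) v = a u v := fun j u v hv => by
    rw [hagree j _ (hpm j u)]
    exact subspaceCorrection_operatorOf (fun w hw hw0 => by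
      rw [SesqForm.quad, ← hagree j w hw]
      exact hpos w hw0) a u hv
  have hp₀v : ∀ u, ∀ v ∈ W₀, a (p₀ u) v = a u v := fun u v hv =>
    subspaceCorrection_operatorOf (fun w _ => hpos w) a u hv
  have hself : ∀ x u : F, a x x = a u x → a x u = (a.quad x : ℂ) := fun x u h => by
    rw [ha.herm x u, ← h, ha.self_eq_quad, Complex.conj_ofReal]
  have hTu : ∀ u, (B * operatorOf a) u = ∑ j, p j u + p₀ u := fun u => by
    simp [hB, p, p₀, LinearMap.sum_apply]
  refine condNumber_le_of_form_bounds ha hpos hL (by positivity)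
    (q := fun u => ∑ j, a.quad (p j u) + a.quad (p₀ u)) ?_ ?_ ?_
  · intro u
    rw [hTu, map_add, LinearMap.add_apply, map_sum, LinearMap.sum_apply,
      hself _ u (hp₀v u _ (hp₀m u)),
      Finset.sum_congr rfl fun j _ => hself _ u (hpv j u _ (hpm j u))]
    push_cast
    rfl
  · intro u
    obtain ⟨f, hfm, hfsum, hfle⟩ := hsplit u
    have hu : a.quad u = ∑ j, (a (f j) (p j u)).re := by
      have h : a u u = ∑ j, a u (f j) := by rw [← map_sum, hfsum]
      rw [SesqForm.quad, h, Complex.re_sum]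
      refine Finset.sum_congr rfl fun j _ => ?_
      rw [← hpv j u _ (hfm j), ha.herm, Complex.conj_re]
    -- Weighted Cauchy–Schwarz; the weight `L` lets the stability bound absorb half of `a(u, u)`.
    have hcs : 2 * L * a.quad u ≤ ∑ j, a.quad (f j) + L ^ 2 * ∑ j, a.quad (p j u) := by
      conv_lhs => rw [hu]
      rw [Finset.mul_sum, Finset.mul_sum, ← Finset.sum_add_distrib]
      exact Finset.sum_le_sum fun j _ => ha.two_mul_re_le L (f j) (p j u)
    have h0 := mul_nonneg (sq_nonneg L) (ha.nonneg (p₀ u))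
    refine le_of_mul_le_mul_left ?_ hL
    linarith
  · intro u
    have hj : ∀ j, a.quad (p j u) ≤ (c j).quad u := by
      intro j
      have h := (hc j).nonneg (u - p j u)
      have e : (c j).quad (p j u) = a.quad (p j u) := by
        rw [SesqForm.quad, ← hagree j _ (hpm j u), SesqForm.quad]
      rw [(hc j).quad_sub, (hc j).herm u, Complex.conj_re, ← hagree j _ (hpm j u),
        hself _ u (hpv j u _ (hpm j u)), Complex.ofReal_re, e] at h
      linarith
    have h₀ : a.quad (p₀ u) ≤ a.quad u := by
      have h := ha.nonneg (u - p₀ u)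
      rw [ha.quad_sub, ha.herm u, Complex.conj_re, hself _ u (hp₀v u _ (hp₀m u)),
        Complex.ofReal_re] at h
      linarith
    have := (Finset.sum_le_sum fun j _ => hj j).trans (hoverlap u)
    linarith

end Corrections

/-! ### Localization of the energy -/

section Localization

variable {d n : ℕ} {Ω : Set (Pt d)} {D : Fin n → Set (Pt d)}

theorem IsRegion.measurableSet {D : Set (Pt d)} (h : IsRegion D) : MeasurableSet D :=
  h.isOpen.measurableSet

/-- The pieces of a division exhaust `Ω` up to their boundaries, which are null sets. -/
theorem IsDivision.volume_diff_eq_zero (h : IsDivision Ω D) : volume (Ω \ ⋃ i, D i) = 0 := by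
  refine measure_mono_null (t := ⋃ i, frontier (D i)) (fun x hx => ?_)
    (measure_iUnion_null fun i => (h.region i).frontier_null)
  have hx' : x ∈ ⋃ i, closure (D i) := h.cover ▸ subset_closure hx.1
  obtain ⟨i, hi⟩ := mem_iUnion.1 hx'
  refine mem_iUnion.2 ⟨i, hi, fun hxi => hx.2 (mem_iUnion.2 ⟨i, interior_subset hxi⟩)⟩

namespace LocalForm

variable {V : Submodule ℂ (L2 Ω)} (a : LocalForm Ω V)

theorem on_eq_zero_of_null {E : Set (Pt d)} (hE : MeasurableSet E) (hΩ : E ⊆ Ω)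
    (h0 : volume E = 0) : a.on E = 0 := by
  ext u v
  refine a.loc E hE hΩ u v ?_
  have h : ∀ᵐ x ∂(volume : Measure (Pt d)), x ∉ E := measure_eq_zero_iff_ae_notMem.1 h0
  filter_upwards [ae_restrict_of_ae h] with x hx hxE using absurd hxE hx

theorem on_biUnion {ι : Type*} (s : Finset ι) {B : ι → Set (Pt d)}
    (hB : ∀ i, MeasurableSet (B i)) (hΩ : ∀ i, B i ⊆ Ω) (hd : ∀ i j, i ≠ j → Disjoint (B i) (B j)) :
    a.on (⋃ i ∈ s, B i) = ∑ i ∈ s, a.on (B i) := by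
  classical
  induction s using Finset.induction_on with
  | empty => simpa using a.on_eq_zero_of_null .empty (empty_subset _) measure_empty
  | insert i s hi ih =>
    rw [Finset.sum_insert hi, Finset.set_biUnion_insert, a.additive _ _ (hB i)
      (s.measurableSet_biUnion fun j _ => hB j) (hΩ i) (iUnion₂_subset fun j _ => hΩ j), ih]
    refine disjoint_iUnion₂_right.2 fun j hj => hd i j ?_
    rintro rfl
    exact hi hj

theorem on_eq_sum_inter (hD : IsDivision Ω D) {E : Set (Pt d)} (hE : MeasurableSet E)
    (hΩ : E ⊆ Ω) : a.on E = ∑ i, a.on (E ∩ D i) := by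
  have hm : ∀ i, MeasurableSet (E ∩ D i) := fun i => hE.inter (hD.region i).measurableSet
  have h1 := a.on_biUnion Finset.univ hm (fun i => inter_subset_left.trans hΩ)
    fun i j hij => (hD.disjoint i j hij).mono inter_subset_right inter_subset_right
  have hU : MeasurableSet (⋃ i, E ∩ D i) := .iUnion hm
  simp only [Finset.mem_univ, iUnion_true] at h1
  have hsub : (⋃ i, E ∩ D i) ⊆ E := iUnion_subset fun i => inter_subset_left
  have h2 := a.additive (⋃ i, E ∩ D i) (E \ ⋃ i, E ∩ D i) hU (hE.diff hU) (hsub.trans hΩ)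
    (sdiff_subset.trans hΩ) disjoint_sdiff_right
  rw [union_sdiff_cancel hsub, h1, a.on_eq_zero_of_null (hE.diff hU) (sdiff_subset.trans hΩ),
    add_zero] at h2
  · exact h2
  · refine measure_mono_null (t := Ω \ ⋃ i, D i)
      (fun x hx => ⟨hΩ hx.1, fun hx' => hx.2 ?_⟩) hD.volume_diff_eq_zero
    obtain ⟨i, hi⟩ := mem_iUnion.1 hx'
    exact mem_iUnion.2 ⟨i, hx.1, hi⟩

theorem quad_eq_sum (hΩ : MeasurableSet Ω) (hD : IsDivision Ω D) (u : V) :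
    (a.on Ω).quad u = ∑ i, (a.on (D i)).quad u := by
  rw [a.on_eq_sum_inter hD hΩ subset_rfl, SesqForm.quad_sum]
  simp only [inter_eq_self_of_subset_right (hD.subset _)]

theorem on_add_on_diff {E E' : Set (Pt d)} (hE : MeasurableSet E) (hE' : MeasurableSet E')
    (hsub : E ⊆ E') (hΩ : E' ⊆ Ω) : a.on E' = a.on E + a.on (E' \ E) := by
  rw [← a.additive E (E' \ E) hE (hE'.diff hE) (hsub.trans hΩ) (sdiff_subset.trans hΩ)
    disjoint_sdiff_right, union_sdiff_cancel hsub]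

theorem quad_mono {E E' : Set (Pt d)} (hE : MeasurableSet E) (hE' : MeasurableSet E')
    (hsub : E ⊆ E') (hΩ : E' ⊆ Ω) (u : V) : (a.on E).quad u ≤ (a.on E').quad u := by
  have h := (a.hermNonneg (E' \ E) (hE'.diff hE) (sdiff_subset.trans hΩ)).nonneg u
  rw [a.on_add_on_diff hE hE' hsub hΩ]
  simp only [SesqForm.quad, LinearMap.add_apply, Complex.add_re] at h ⊢
  linarith

end LocalForm

end Localization

section Discrete

variable {d : ℕ} {P : Discretization d}

theorem Discretization.ah_hermNonneg (P : Discretization d) {D : Set (Pt d)}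
    (hD : MeasurableSet D) (hΩ : D ⊆ P.Ω) : (P.ah D).IsHermNonneg :=
  (P.a.hermNonneg D hD hΩ).onSub P.Vh

theorem Discretization.ah_Ω_hermNonneg (P : Discretization d) : (P.ah P.Ω).IsHermNonneg :=
  P.ah_hermNonneg P.region.measurableSet subset_rfl

theorem Discretization.ah_Ω_pos (P : Discretization d) (u : P.Vh) (hu : u ≠ 0) :
    0 < (P.ah P.Ω).quad u :=
  P.posDef u (by simpa using hu)

theorem Discretization.exists_orth_decomp (P : Discretization d) (W : Submodule ℂ P.Vh)
    (u : P.Vh) : ∃ p ∈ W, (∀ v ∈ W, P.ah P.Ω (u - p) v = 0) ∧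
      (P.ah P.Ω).quad (u - p) ≤ (P.ah P.Ω).quad u :=
  SesqForm.IsHermNonneg.exists_orth_decomp (F := P.Vh) (a := P.ah P.Ω) P.ah_Ω_hermNonneg
    P.ah_Ω_pos W u

/-- On functions supported in `D`, the local form `a(·,·)_D` is the global one: the local solvers
are exact. -/
theorem Discretization.ah_eq_of_mem_supportedIn {D : Set (Pt d)} (hD : MeasurableSet D)
    (hΩ : D ⊆ P.Ω) {u : P.Vh} (hu : u ∈ P.supportedIn D) (v : P.Vh) :
    P.ah P.Ω u v = P.ah D u v := by
  have h0 : P.a.on (P.Ω \ D) u v = 0 := by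
    refine P.a.loc _ (P.region.measurableSet.diff hD) sdiff_subset _ _ ?_
    have hu' : ∀ᵐ x ∂(volume.restrict P.Ω), x ∈ Dᶜ → P.fn u x = 0 := hu
    filter_upwards [hu'] with x hx hxD using hx hxD.2
  have h := P.a.on_add_on_diff hD P.region.measurableSet hΩ subset_rfl
  change P.a.on P.Ω u v = P.a.on D u v
  rw [h, LinearMap.add_apply, LinearMap.add_apply, h0, add_zero]

variable {Q : Decomposition P}

theorem Decomposition.card_nbrs_le (i : Fin Q.N) : (Q.nbrs i).ncard ≤ Q.overlap :=
  Finset.le_sup (f := fun i => (Q.nbrs i).ncard) (Finset.mem_univ i)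

/-- Finite overlap: if `f i j` vanishes unless `Ω'_j` meets `Ω'_i` and is otherwise at most `g i`,
then the double sum is at most `M ∑ g`. -/
theorem Decomposition.sum_sum_le_overlap_mul (f : Fin Q.N → Fin Q.N → ℝ) (g : Fin Q.N → ℝ)
    (hg : ∀ i, 0 ≤ g i) (hf : ∀ i, ∀ j ∈ Q.nbrs i, f i j ≤ g i)
    (hf0 : ∀ i, ∀ j ∉ Q.nbrs i, f i j ≤ 0) :
    ∑ j, ∑ i, f i j ≤ Q.overlap * ∑ i, g i := by
  classical
  rw [Finset.sum_comm, Finset.mul_sum]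
  refine Finset.sum_le_sum fun i _ => ?_
  calc ∑ j, f i j ≤ ∑ j, if j ∈ Q.nbrs i then g i else 0 := by
        refine Finset.sum_le_sum fun j _ => ?_
        split_ifs with h
        exacts [hf i j h, hf0 i j h]
    _ = (Q.nbrs i).ncard * g i := by
        rw [← Finset.sum_filter, Finset.sum_const, nsmul_eq_mul, Set.ncard_eq_toFinset_card',
          Set.toFinset]
        congr 3
        ext j
        simp
    _ ≤ Q.overlap * g i :=
        mul_le_mul_of_nonneg_right (by exact_mod_cast Q.card_nbrs_le i) (hg i)

theorem Decomposition.disjoint_closure_of_notMem_nbrs {i j : Fin Q.N} (h : j ∉ Q.nbrs i) :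
    Disjoint (closure (Q.ovl j)) (Q.sub i) := by
  have h' : Disjoint (Q.ovl j) (Q.sub i) := by
    rw [Set.disjoint_iff_inter_eq_empty, ← Set.not_nonempty_iff_eq_empty]
    exact fun hne => h (hne.mono (inter_subset_inter_right _ (Q.sub_subset i)))
  exact h'.closure_left (Q.division.region i).isOpen

/-- The energies on the overlapping subdomains add up to at most `M` times the energy. -/
theorem Decomposition.sum_quad_ovl_le (Q : Decomposition P) (u : P.Vh) :
    ∑ j, (P.ah (Q.ovl j)).quad u ≤ Q.overlap * (P.ah P.Ω).quad u := by
  have hm := fun j => (Q.ovl_region j).measurableSet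
  have hs := fun i => (Q.division.region i).measurableSet
  calc ∑ j, (P.ah (Q.ovl j)).quad u
      = ∑ j, ∑ i, (P.a.on (Q.ovl j ∩ Q.sub i)).quad (u : P.V) := by
        refine Finset.sum_congr rfl fun j _ => ?_
        rw [← SesqForm.quad_sum, ← P.a.on_eq_sum_inter Q.division (hm j) (Q.ovl_subset j)]
        rfl
    _ ≤ Q.overlap * ∑ i, (P.a.on (Q.sub i)).quad (u : P.V) := by
        refine Q.sum_sum_le_overlap_mul (fun i j => (P.a.on (Q.ovl j ∩ Q.sub i)).quad (u : P.V)) _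
          (fun i => (P.a.hermNonneg _ (hs i) (Q.division.subset i)).nonneg _) (fun i j _ => ?_)
          fun i j hj => ?_
        · exact P.a.quad_mono ((hm j).inter (hs i)) (hs i) inter_subset_right
            (Q.division.subset i) _
        · have h := (Q.disjoint_closure_of_notMem_nbrs hj).mono_left subset_closure
          rw [h.inter_eq, P.a.on_eq_zero_of_null .empty (empty_subset _) measure_empty]
          simp [SesqForm.quad]
    _ = Q.overlap * (P.ah P.Ω).quad u := by
        rw [← P.a.quad_eq_sum P.region.measurableSet Q.division]
        rfl

end Discrete

/-! ### The auxiliary norms are dominated by the energy -/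

section Auxiliary

variable {d : ℕ} {P : Discretization d} {Q : Decomposition P} {S : AuxForms Q}
  (E : Eigenbasis S) {Λ : ℝ}

theorem AuxForms.sh_hermNonneg (S : AuxForms Q) (i : Fin Q.N) : (S.sh i).IsHermNonneg :=
  (S.hermNonneg i).onSub P.Vh

/-- Eigenvalues below the threshold: `1 = s(φ, φ) = λ a(φ, φ) ≤ Λ a(φ, φ)`. -/
theorem Eigenbasis.one_le_of_notMem_kept (hΛ : 0 < Λ) {i : Fin Q.N} {j : Fin (E.n i)}
    (hj : j ∉ E.kept Λ i) : 1 ≤ Λ * (P.ah (Q.sub i)).quad (E.φ i j) := by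
  have hlt : E.lam i j < ENNReal.ofReal Λ := by simpa [Eigenbasis.kept] using hj
  have h1 := (E.eigen i j).1 (hlt.trans ENNReal.ofReal_lt_top).ne (E.φ i j)
  have hle : (E.lam i j).toReal ≤ Λ := ENNReal.toReal_le_of_le_ofReal hΛ.le hlt.le
  have ha : (P.ah (Q.sub i)).IsHermNonneg :=
    P.ah_hermNonneg (Q.division.region i).measurableSet (Q.division.subset i)
  rw [E.norm_s, ha.self_eq_quad] at h1
  have h2 : (1 : ℝ) = (E.lam i j).toReal * (P.ah (Q.sub i)).quad (E.φ i j) := by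
    exact_mod_cast h1
  rw [h2]
  exact mul_le_mul_of_nonneg_right hle (ha.nonneg _)

/-- The part of `u` that `π_i` does not see is controlled by the local energy. -/
theorem Eigenbasis.quad_s_le (hΛ : 0 < Λ) (i : Fin Q.N) (u : P.Vh) :
    (S.sh i).quad u ≤ (S.sh i).quad (E.proj Λ i u) + Λ * (P.ah (Q.sub i)).quad u := by
  have hm := (Q.division.region i).measurableSet
  obtain ⟨x, hx⟩ := E.basis i u
  exact (S.sh_hermNonneg i).quad_le_quad_orthProj_add (P.ah_hermNonneg hm (Q.division.subset i))
    (E.orth_s i) (E.orth_a i) (E.norm_s i) hΛ.le (fun j hj => E.one_le_of_notMem_kept hΛ hj)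
    (fun v => S.loc i _ v hx) fun v => P.a.loc _ hm (Q.division.subset i) _ v hx

theorem Eigenbasis.proj_sub_of_mem_Vtilde {v : P.Vh} (hv : v ∈ E.Vtilde Λ) (u : P.Vh)
    (i : Fin Q.N) : E.proj Λ i (u - v) = E.proj Λ i u := by
  refine orthProj_sub_of_orth (fun j hj => ?_) u
  have h := (Submodule.mem_iInf _).1 hv i
  have h' := (Submodule.mem_iInf _).1 h (E.φ i j)
  exact (Submodule.mem_iInf _).1 h' (Submodule.subset_span ⟨j, hj, rfl⟩)

/-- Split `u = u₀ + ũ` with `u₀ ∈ V₀` and `ũ ∈ Ṽ`, orthogonally for the energy.  As `π_l ũ = 0`, the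
Poincaré inequality on `V₀` bounds `π_l u = π_l u₀`, and the rest of `u` has small eigenvalues. -/
theorem Eigenbasis.sum_quad_s_le (hΛ : 0 < Λ) {Cp : ℝ} (hCp : 0 ≤ Cp) (h3 : Assumption3 E Λ Cp)
    (u : P.Vh) : ∑ l, (S.sh l).quad u ≤ (Cp + Λ) * (P.ah P.Ω).quad u := by
  obtain ⟨p, hpm, hpv, hle⟩ := P.exists_orth_decomp (E.Vtilde Λ) u
  have hu0 : u - p ∈ E.V0 Λ :=
    (Submodule.mem_iInf _).2 fun v => (Submodule.mem_iInf _).2 fun hv => hpv v hv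
  have h0 := h3 _ hu0
  simp only [E.proj_sub_of_mem_Vtilde hpm] at h0
  have hsum : ∑ l, Λ * (P.ah (Q.sub l)).quad u = Λ * (P.ah P.Ω).quad u := by
    rw [← Finset.mul_sum]
    exact congrArg _ (P.a.quad_eq_sum P.region.measurableSet Q.division (u : P.V)).symm
  calc ∑ l, (S.sh l).quad u
      ≤ ∑ l, ((S.sh l).quad (E.proj Λ l u) + Λ * (P.ah (Q.sub l)).quad u) :=
        Finset.sum_le_sum fun l _ => E.quad_s_le hΛ l u
    _ = ∑ l, (S.sh l).quad (E.proj Λ l u) + Λ * (P.ah P.Ω).quad u :=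
        Finset.sum_add_distrib.trans (congrArg _ hsum)
    _ ≤ Cp * (P.ah P.Ω).quad u + Λ * (P.ah P.Ω).quad u :=
        add_le_add (h0.trans (mul_le_mul_of_nonneg_left hle hCp)) le_rfl
    _ = (Cp + Λ) * (P.ah P.Ω).quad u := (add_mul ..).symm

end Auxiliary

/-! ### Stable splittings and the condition number -/

section Splitting

variable {d : ℕ} {P : Discretization d} {Q : Decomposition P} {S : AuxForms Q}

/-- The splitting `u = ∑ I_h(θ_j u)` is stable in the norm `a(u, u) + ∑ s_l(u, u)`. -/
theorem Decomposition.exists_stable_splitting {C Ca Cs : ℝ} (hC : 0 ≤ C) (hCa : 0 ≤ Ca)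
    (h1 : Assumption1 S C) (h2 : Assumption2 S Ca Cs) (u : P.Vh) :
    ∃ f : Fin Q.N → P.Vh, (∀ j, f j ∈ P.supportedIn (Q.ovl j)) ∧ ∑ j, f j = u ∧
      ∑ j, (P.ah P.Ω).quad (f j) ≤
        Ca * (Q.overlap * (C * ((P.ah P.Ω).quad u + ∑ l, (S.sh l).quad u))) := by
  have hΩ := P.region.measurableSet
  have hs := fun i => (Q.division.region i).measurableSet
  choose w hw using fun j => Q.θ_mul j u
  have hsum : ∑ j, w j = (u : P.V) := by
    apply Subtype.ext
    rw [AddSubmonoidClass.coe_finsetSum]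
    apply Lp.ext
    have hall : ∀ᵐ x ∂(volume.restrict P.Ω), ∀ j, (w j : L2 P.Ω) x = (Q.θ j x : ℂ) * P.fn u x :=
      ae_all_iff.2 fun j => (hw j).mono fun x hx => hx (mem_univ x)
    filter_upwards [Lp.coeFn_finsetSum Finset.univ (fun j => (w j : L2 P.Ω)), hall,
      ae_restrict_mem hΩ] with x hx1 hx2 hx3
    rw [hx1, Finset.sum_apply, Finset.sum_congr rfl fun j _ => hx2 j, ← Finset.sum_mul,
      ← Complex.ofReal_sum, Q.θ_sum x (subset_closure hx3), Complex.ofReal_one, one_mul]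
    rfl
  refine ⟨fun j => Q.Ih (w j), fun j => Q.Ih_supp j u (w j) (hw j), ?_, ?_⟩
  · rw [← map_sum, hsum, Q.Ih_proj]
  have hIh : ∀ j, (P.ah P.Ω).quad (Q.Ih (w j)) ≤ Ca * (P.a.on P.Ω).quad (w j) := by
    intro j
    have := P.a.quad_eq_sum hΩ P.mesh (Q.Ih (w j) : P.V)
    rw [P.a.quad_eq_sum hΩ P.mesh (w j), Finset.mul_sum]
    calc (P.ah P.Ω).quad (Q.Ih (w j)) = ∑ t, (P.ah (P.cell t)).quad (Q.Ih (w j)) := this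
      _ ≤ _ := Finset.sum_le_sum fun t _ => h2.bound_a (w j) t
  have hlocal : ∑ j, (P.a.on P.Ω).quad (w j) ≤
      Q.overlap * ∑ i, C * ((P.ah (Q.sub i)).quad u + (S.sh i).quad u) := by
    simp only [P.a.quad_eq_sum hΩ Q.division]
    refine Q.sum_sum_le_overlap_mul (fun i j => (P.a.on (Q.sub i)).quad (w j)) _ (fun i => ?_)
      (fun i j hj => h1.bound i j hj u (w j) (hw j)) fun i j hj => ?_
    · exact mul_nonneg hC (add_nonneg
        ((P.ah_hermNonneg (hs i) (Q.division.subset i)).nonneg u) ((S.sh_hermNonneg i).nonneg u))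
    · -- The open set `Ω_i` does not meet the closure of `Ω'_j`, so `θ_j` vanishes on it.
      have hdisj := Q.disjoint_closure_of_notMem_nbrs hj
      have h0 : P.a.on (Q.sub i) (w j) (w j) = 0 := by
        refine P.a.loc _ (hs i) (Q.division.subset i) _ _ ?_
        filter_upwards [hw j] with x hx hxi
        rw [hx (mem_univ x), Q.θ_supp j x (subset_closure (Q.division.subset i hxi))
          (hdisj.notMem_of_mem_right hxi), Complex.ofReal_zero, zero_mul]
      simp [SesqForm.quad, h0]
  have hquad : ∑ l, (P.ah (Q.sub l)).quad u = (P.ah P.Ω).quad u :=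
    (P.a.quad_eq_sum hΩ Q.division (u : P.V)).symm
  rw [← Finset.mul_sum, Finset.sum_add_distrib, hquad] at hlocal
  calc ∑ j, (P.ah P.Ω).quad (Q.Ih (w j)) ≤ ∑ j, Ca * (P.a.on P.Ω).quad (w j) :=
        Finset.sum_le_sum fun j _ => hIh j
    _ = Ca * ∑ j, (P.a.on P.Ω).quad (w j) := (Finset.mul_sum ..).symm
    _ ≤ _ := mul_le_mul_of_nonneg_left hlocal hCa

theorem Eigenbasis.condNumber_precond_le (E : Eigenbasis S) (Λ : ℝ) (k : ℕ) {L : ℝ} (hL : 0 < L)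
    (hsplit : ∀ u : P.Vh, ∃ f : Fin Q.N → P.Vh, (∀ j, f j ∈ P.supportedIn (Q.ovl j)) ∧
      ∑ j, f j = u ∧ ∑ j, (P.ah P.Ω).quad (f j) ≤ L * (P.ah P.Ω).quad u) :
    (∀ z ∈ spectrum ℂ (E.precond Λ k * P.Ah), ∃ t : ℝ, 0 < t ∧ z = (t : ℂ)) ∧
      condNumber (F := P.Vh) (E.precond Λ k * P.Ah) ≤ (Q.overlap + 1) * L := by
  have h := condNumber_additiveSchwarz_le (F := P.Vh) (a := P.ah P.Ω)
    (c := fun j => P.ah (Q.ovl j)) (W := fun j => P.supportedIn (Q.ovl j)) (W₀ := E.coarse Λ k)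
    (m := Q.overlap) (L := L) (B := E.precond Λ k) P.ah_Ω_hermNonneg P.ah_Ω_pos
  have h' := h
    (fun j => P.ah_hermNonneg (Q.ovl_region j).measurableSet (Q.ovl_subset j))
    (fun j u hu v =>
      P.ah_eq_of_mem_supportedIn (u := u) (Q.ovl_region j).measurableSet (Q.ovl_subset j) hu v)
    (Nat.cast_nonneg _) hL Q.sum_quad_ovl_le
  exact h' hsplit rfl

end Splitting

end TLOS

theorem mainTheorem3 (Λ : ℝ) (hΛ : 1 < Λ) (M : ℕ)
    (C Ca Cs Cp : ℝ) (hC : 0 < C) (hCa : 0 < Ca) (hCs : 0 < Cs) (hCp : 0 < Cp) :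
    ∃ K : ℝ, 0 < K ∧
      ∀ (d : ℕ) (P : TLOS.Discretization d) (Q : TLOS.Decomposition P) (S : TLOS.AuxForms Q)
        (E : TLOS.Eigenbasis S) (k : ℕ),
        Q.overlap = M → 2 ≤ k →
        TLOS.Assumption1 S C → TLOS.Assumption2 S Ca Cs → TLOS.Assumption3 E Λ Cp →
        (∀ z ∈ spectrum ℂ (E.precond Λ k * P.Ah), ∃ t : ℝ, 0 < t ∧ z = (t : ℂ)) ∧
          TLOS.condNumber (F := P.Vh) (E.precond Λ k * P.Ah) ≤ K := by
  have hΛ0 : 0 < Λ := one_pos.trans hΛ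
  -- The summand `1` keeps the splitting constant positive in the empty case `M = 0`.
  have hL : 0 < Ca * (M * (C * (1 + (Cp + Λ)))) + 1 := by positivity
  refine ⟨(M + 1) * (Ca * (M * (C * (1 + (Cp + Λ)))) + 1), by positivity, ?_⟩
  rintro d P Q S E k rfl - h1 h2 h3
  refine E.condNumber_precond_le Λ k hL fun u => ?_
  obtain ⟨f, hfm, hfsum, hfle⟩ := Q.exists_stable_splitting hC.le hCa.le h1 h2 u
  refine ⟨f, hfm, hfsum, hfle.trans ?_⟩
  have ha := P.ah_Ω_hermNonneg.nonneg u
  have hs := E.sum_quad_s_le hΛ0 hCp.le h3 u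
  calc Ca * (Q.overlap * (C * ((P.ah P.Ω).quad u + ∑ l, (S.sh l).quad u)))
      ≤ Ca * (Q.overlap * (C * ((P.ah P.Ω).quad u + (Cp + Λ) * (P.ah P.Ω).quad u))) := by gcongr
    _ ≤ (Ca * (Q.overlap * (C * (1 + (Cp + Λ)))) + 1) * (P.ah P.Ω).quad u := by linarith
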